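/- Conventions. Let $\tau$ be a vocabulary (a set of predicate, function and constant symbols). Structures are non-empty and may be finite or infinite; substructures are non-empty as well. A theory is a set of first-order $\tau$-sentences. $\mathbb{N}$ includes $0$. Let $\mathcal{U}$ be a class of structures, $\mathcal{S}\subseteq\mathcal{U}$ a subclass, and $k\in\mathbb{N}$. * $\mathcal{S}$ is *$k$-hereditary over $\mathcal{U}$* if for every $\mathfrak{A}\in\mathcal{S}$ there is a set $C$ of at most $k$ elements of $\mathfrak{A}$ (a *$k$-crux*) such that every substructure $\mathfrak{B}\subseteq\mathfrak{A}$ that contains $C$ and belongs to $\mathcal{U}$ belongs to $\mathcal{S}$. * A non-empty collection $\mathcal{R}$ of substructures of $\mathfrak{A}$ is a *$k$-ary cover* of $\mathfrak{A}$, and $\mathfrak{A}$ is a *$k$-extension* of $\mathcal{R}$, if every set of at most $k$ elements of $\mathfrak{A}$ is contained in some member of $\mathcal{R}$. $\mathcal{S}$ is *$k$-extension closed over $\mathcal{U}$* if, for every collection $\mathcal{R}$ of structures in $\mathcal{S}$, every $k$-extension of $\mathcal{R}$ that belongs to $\mathcal{U}$ belongs to $\mathcal{S}$. * For theories $T,V$,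 $T$ is *$k$-hereditary* (resp. *$k$-extension closed*) *modulo $V$* if the class of models of $T\cup V$ is $k$-hereditary (resp. $k$-extension closed) over the class of models of $V$. For a formula $\varphi(\bar x)$ with free variables among $\bar x=(x_1,\dots,x_n)$, let $\tau_n$ be the expansion of $\tau$ by $n$ fresh distinct constants $c_1,\dots,c_n$; $\varphi(\bar x)$ is *$k$-hereditary* (resp. *$k$-extension closed*) *modulo $V$* if the $\tau_n$-theory $\{\varphi(c_1,\dots,c_n)\}$ is so modulo $V$, where $V$ is seen as a $\tau_n$-theory. * Formulas $\varphi(\bar x),\psi(\bar x)$ are *equivalent modulo $V$* if for every $\tau$-structure $\mathfrak{A}$ and every $n$-tuple $\bar a$ from $\mathfrak{A}$, $(\mathfrak{A},\bar a)$ is a model of $\{\varphi(\bar x)\}\cup V$ iff it is a model of $\{\psi(\bar x)\}\cup V$. * An *$\exists^k\forall^*$ formula* (resp. *$\forall^k\exists^*$ formula*) consists of exactly $k$ existential (resp. universal) quantifiers, followed by any finite number, possibly zero, of universal (resp. existential) quantifiers, followed by a quantifier-free formula. **Theorem (generalized Łoś–Tarski theorem, $\mathsf{GLT}(k)$).** Let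 $\varphi(\bar x)$ be a first-order $\tau$-formula with free variables among $\bar x=(x_1,\dots,x_n)$, let $V$ be a $\tau$-theory, and let $k\in\mathbb{N}$. Then: 1. $\varphi(\bar x)$ is $k$-hereditary modulo $V$ if and only if it is equivalent modulo $V$ to an $\exists^k\forall^*$ formula whose free variables are among $\bar x$. 2. $\varphi(\bar x)$ is $k$-extension closed modulo $V$ if and only if it is equivalent modulo $V$ to a $\forall^k\exists^*$ formula whose free variables are among $\bar x$. -/

import Mathlib

open FirstOrder FirstOrder.Language CategoryTheory

universe u v w

namespace GLT

/-! ### Classes of structures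

A class of `L`-structures is a set of bundled structures `Set (Bundled.{w} L.Structure)`.
Mathlib allows empty structures, so non-emptiness of the universe is required explicitly where
structures are quantified (in `modelClass` and in `EquivalentModulo`). -/

section Classes

variable {L : FirstOrder.Language.{u, v}}

/-- A substructure of `A`, regarded as a structure in its own right. -/
def substr {A : Bundled.{w} L.Structure} (B : L.Substructure A) : Bundled.{w} L.Structure :=
  ⟨B, inferInstance⟩

/-- `C` is a `k`-crux of `A` w.r.t. `S` over `U`: it has at most `k` elements, and every
substructure of `A` that contains `C` and lies in `U` lies in `S`. -/
def IsCrux (k : ℕ) (S U : Set (Bundled.{w} L.Structure)) (A : Bundled.{w} L.Structure)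
    (C : Finset A) : Prop :=
  C.card ≤ k ∧ ∀ B : L.Substructure A, (C : Set A) ⊆ (B : Set A) → substr B ∈ U → substr B ∈ S

/-- The subclass `S` of `U` is `k`-hereditary over `U`. -/
def HereditaryOver (k : ℕ) (S U : Set (Bundled.{w} L.Structure)) : Prop :=
  S ⊆ U ∧ ∀ A ∈ S, ∃ C : Finset A, IsCrux k S U A C

/-- The collection `R` of substructures of `A` is a `k`-ary cover of `A`; in other words, `A` is a
`k`-extension of `R`. -/
def IsCover (k : ℕ) (A : Bundled.{w} L.Structure) (R : Set (L.Substructure A)) : Prop :=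
  R.Nonempty ∧ ∀ C : Finset A, C.card ≤ k → ∃ B ∈ R, (C : Set A) ⊆ (B : Set A)

/-- The subclass `S` of `U` is `k`-extension closed over `U`. -/
def ExtensionClosedOver (k : ℕ) (S U : Set (Bundled.{w} L.Structure)) : Prop :=
  S ⊆ U ∧ ∀ A ∈ U, ∀ R : Set (L.Substructure A),
    (∀ B ∈ R, substr B ∈ S) → IsCover k A R → A ∈ S

/-- The class of (non-empty) models of a theory. -/
def modelClass (T : L.Theory) : Set (Bundled.{w} L.Structure) :=
  {A | Nonempty A ∧ A ⊨ T}

/-- The theory `T` is `k`-hereditary modulo the theory `V`. -/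
def TheoryHereditary (k : ℕ) (T V : L.Theory) : Prop :=
  HereditaryOver k (modelClass.{u, v, w} (T ∪ V)) (modelClass.{u, v, w} V)

/-- The theory `T` is `k`-extension closed modulo the theory `V`. -/
def TheoryExtensionClosed (k : ℕ) (T V : L.Theory) : Prop :=
  ExtensionClosedOver k (modelClass.{u, v, w} (T ∪ V)) (modelClass.{u, v, w} V)

end Classes

/-! ### Formulas and theories with free variables

`L[[Fin n]]` is the expansion of `L` by `n` fresh distinct constant symbols. -/

section FreeVariables

variable {L : FirstOrder.Language.{u, v}} {n : ℕ}

/-- The `L[[Fin n]]`-theory obtained from an `L`-theory with free variables `x₁, …, xₙ` by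
substituting the `i`-th fresh constant for `xᵢ`. -/
def closeTheory (T : Set (L.Formula (Fin n))) : (L[[Fin n]]).Theory :=
  Formula.equivSentence '' T

/-- An `L`-theory, seen as an `L[[Fin n]]`-theory. -/
def expandTheory (n : ℕ) (V : L.Theory) : (L[[Fin n]]).Theory :=
  (L.lhomWithConstants (Fin n)).onTheory V

/-- The formula `φ(x₁, …, xₙ)` is `k`-hereditary modulo `V`. -/
def FormulaHereditary (k : ℕ) (φ : L.Formula (Fin n)) (V : L.Theory) : Prop :=
  TheoryHereditary.{u, v, w} k (closeTheory {φ}) (expandTheory n V)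

/-- The formula `φ(x₁, …, xₙ)` is `k`-extension closed modulo `V`. -/
def FormulaExtensionClosed (k : ℕ) (φ : L.Formula (Fin n)) (V : L.Theory) : Prop :=
  TheoryExtensionClosed.{u, v, w} k (closeTheory {φ}) (expandTheory n V)

/-- `φ` and `ψ` are equivalent modulo `V`: for each structure `A` and each `n`-tuple `a` of
elements of `A`, `(A, a)` is a model of `{φ} ∪ V` iff it is a model of `{ψ} ∪ V`. -/
def EquivalentModulo (V : L.Theory) (φ ψ : L.Formula (Fin n)) : Prop :=
  ∀ (A : Type w) [L.Structure A] [Nonempty A] (a : Fin n → A),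
    (φ.Realize a ∧ A ⊨ V) ↔ (ψ.Realize a ∧ A ⊨ V)

/-- `ψ` is an `∃ᵏ∀*` formula: `k` existential quantifiers, then any number (possibly zero) of
universal quantifiers, then a quantifier-free formula. -/
def IsExistsForall (k : ℕ) (ψ : L.Formula (Fin n)) : Prop :=
  ∃ χ : L.BoundedFormula (Fin n) k, χ.IsUniversal ∧ ψ = χ.exs

/-- `ψ` is a `∀ᵏ∃*` formula: `k` universal quantifiers, then any number (possibly zero) of
existential quantifiers, then a quantifier-free formula. -/
def IsForallExists (k : ℕ) (ψ : L.Formula (Fin n)) : Prop :=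
  ∃ χ : L.BoundedFormula (Fin n) k, χ.IsExistential ∧ ψ = χ.alls

end FreeVariables

end GLT

-- The two parts are dual: `S` is `k`-hereditary over `U` iff `U \ S` is `k`-extension closed over
-- `U`, and negation exchanges the two prefixes. So only extension closure needs work, and there one
-- direction is easy: a `k`-tuple lies in a member of the cover, and existential witnesses persist
-- upwards.
--
-- For the converse, let `φ` be `k`-extension closed modulo `V`, and let `(A, p)` be a model of `V`
-- and of all `∀ᵏ∃*` consequences of `V ∪ {φ}`. It suffices to show that `φ` holds at `p`
-- (`exists_isForallExists_of_consequences`): compactness then isolates finitely many consequences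
-- that imply `φ`, and they merge into one. Each `k`-tuple `x` of `A` has a model of `V ∪ {φ}` with
-- a tuple whose existential properties are shared by `(p, x)` (`exists_exPreserved`). All these
-- models embed into one elementary extension of `A` over their tuples, since every finite part of
-- their diagrams is realised in `A` (`exists_elementary_extension`). Now all `k`-tuples of `A` are
-- covered, but not the new ones; the union `N` of an elementary chain of such extensions repairs
-- this. So `N` is a `k`-extension of models of `V ∪ {φ}`, whence `φ` holds at `p` in `N`, and
-- therefore in `A`.

universe w'

namespace GLT

/-! ### Compactness and normal forms for existential formulas -/

section Formulas

open BoundedFormula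

variable {L : FirstOrder.Language.{u, v}}

/-- Compactness for a theory together with a family of formulas in arbitrarily many variables. -/
theorem exists_realize_of_finset {α : Type w} {ι : Type*} (V : L.Theory) (σ : ι → L.Formula α)
    (h : ∀ F : Finset ι, ∃ (M : Type max u v w w') (_ : L.Structure M) (_ : Nonempty M) (v : α → M),
      M ⊨ V ∧ ∀ i ∈ F, (σ i).Realize v) :
    ∃ (M : Type max u v w w') (_ : L.Structure M) (_ : Nonempty M) (v : α → M),
      M ⊨ V ∧ ∀ i, (σ i).Realize v := by
  classical
  have hsat : ((L.lhomWithConstants α).onTheory V ∪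
      Set.range fun i => Formula.equivSentence (σ i)).IsSatisfiable := by
    rw [Theory.isSatisfiable_iff_isFinitelySatisfiable]
    intro T₀ hT₀
    obtain ⟨F, hF⟩ : ∃ F : Finset ι, ∀ θ ∈ T₀, θ ∈ (L.lhomWithConstants α).onTheory V ∨
        ∃ i ∈ F, Formula.equivSentence (σ i) = θ := by
      refine ⟨T₀.biUnion fun θ => if hθ : ∃ i, Formula.equivSentence (σ i) = θ then
        {hθ.choose} else ∅, fun θ hθ => ?_⟩
      rcases hT₀ hθ with h1 | h1
      · exact Or.inl h1
      · have h2 : ∃ i, Formula.equivSentence (σ i) = θ := h1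
        refine Or.inr ⟨h2.choose, ?_, h2.choose_spec⟩
        rw [Finset.mem_biUnion]
        exact ⟨θ, hθ, by rw [dif_pos h2]; simp⟩
    obtain ⟨M, _, _, v, hV, hv⟩ := h F
    let := constantsOn.structure v
    have : M ⊨ (T₀ : L[[α]].Theory) := by
      refine ⟨fun θ hθ => ?_⟩
      rcases hF θ hθ with h1 | ⟨i, hi, rfl⟩
      · exact ((LHom.onTheory_model (L.lhomWithConstants α) V).2 hV).realize_of_mem θ h1
      · rw [Formula.realize_equivSentence]
        exact hv i hi
    exact Theory.Model.isSatisfiable M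
  obtain ⟨M₀⟩ := hsat
  let M := Theory.ModelType.ulift.{_, _, _, w'} M₀
  let : L.Structure M := (L.lhomWithConstants α).reduct M
  refine ⟨M, inferInstance, inferInstance, fun a => (L.con a : M), ?_, fun i => ?_⟩
  · exact (LHom.onTheory_model (L.lhomWithConstants α) V).1
      (M.is_model.mono Set.subset_union_left)
  · rw [← Formula.realize_equivSentence]
    exact M.is_model.realize_of_mem _ (Or.inr ⟨i, rfl⟩)

theorem realize_congr_freeVarFinset {α : Type*} [DecidableEq α] {M : Type*} [L.Structure M]
    (φ : L.Formula α) {v v' : α → M} (h : ∀ a ∈ φ.freeVarFinset, v a = v' a) :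
    φ.Realize v ↔ φ.Realize v' := by
  unfold Formula.Realize
  rw [← realize_restrictFreeVar' (φ := φ) (s := φ.freeVarFinset) subset_rfl (v := v),
    ← realize_restrictFreeVar' (φ := φ) (s := φ.freeVarFinset) subset_rfl (v := v')]
  congr! 1
  exact funext fun a => h a a.2

theorem _root_.FirstOrder.Language.BoundedFormula.IsQF.relabelFormula {α β : Type*}
    {φ : L.Formula α} (h : φ.IsQF) (f : α → β) : (Formula.relabel f φ).IsQF :=
  IsQF.relabel h _

theorem exists_isQF_disj {α : Type*} (F : Finset (L.Formula α)) (hF : ∀ δ ∈ F, δ.IsQF) :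
    ∃ D : L.Formula α, D.IsQF ∧ ∀ (M : Type w) [L.Structure M] (v : α → M),
      D.Realize v ↔ ∃ δ ∈ F, δ.Realize v := by
  classical
  induction F using Finset.induction_on with
  | empty => exact ⟨⊥, isQF_bot, fun M _ v => by simp⟩
  | insert δ F _ ih =>
    obtain ⟨D, hD, h⟩ := ih fun δ' h' => hF δ' (Finset.mem_insert_of_mem h')
    exact ⟨δ ⊔ D, (hF δ (Finset.mem_insert_self _ _)).sup hD, fun M _ v => by
      simp [Formula.realize_sup, h]⟩

theorem exists_isQF_conj {α : Type*} (F : Finset (L.Formula α)) (hF : ∀ δ ∈ F, δ.IsQF) :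
    ∃ D : L.Formula α, D.IsQF ∧ ∀ (M : Type w) [L.Structure M] (v : α → M),
      D.Realize v ↔ ∀ δ ∈ F, δ.Realize v := by
  classical
  induction F using Finset.induction_on with
  | empty => exact ⟨⊤, IsQF.top, fun M _ v => by simp⟩
  | insert δ F _ ih =>
    obtain ⟨D, hD, h⟩ := ih fun δ' h' => hF δ' (Finset.mem_insert_of_mem h')
    exact ⟨δ ⊓ D, (hF δ (Finset.mem_insert_self _ _)).inf hD, fun M _ v => by
      simp [Formula.realize_inf, h]⟩

/-- The formula `∃ y, δ(a, y)`, where `y` stands for the variables indexed by `ℕ`. -/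
def ExRealize {γ : Type*} (δ : L.Formula (γ ⊕ ℕ)) {M : Type*} [L.Structure M] (a : γ → M) : Prop :=
  ∃ y : ℕ → M, δ.Realize (Sum.elim a y)

theorem exists_exRealize_conj {γ : Type*} (F : Finset (L.Formula (γ ⊕ ℕ)))
    (hF : ∀ δ ∈ F, δ.IsQF) :
    ∃ D : L.Formula (γ ⊕ ℕ), D.IsQF ∧ ∀ (M : Type w) [L.Structure M] [Nonempty M] (a : γ → M),
      ExRealize D a ↔ ∀ δ ∈ F, ExRealize δ a := by
  classical
  induction F using Finset.induction_on with
  | empty => exact ⟨⊤, IsQF.top, fun M _ _ a => by simp [ExRealize]⟩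
  | insert δ F _ ih =>
    obtain ⟨D, hD, h⟩ := ih fun δ' h' => hF δ' (Finset.mem_insert_of_mem h')
    -- Splitting `ℕ` into two copies keeps the witnesses of `δ` and of `D` apart.
    let e := Equiv.natSumNatEquivNat
    refine ⟨δ.relabel (Sum.map id (e ∘ Sum.inl)) ⊓ D.relabel (Sum.map id (e ∘ Sum.inr)),
      ((hF δ (Finset.mem_insert_self _ _)).relabelFormula _).inf (hD.relabelFormula _),
      fun M _ _ a => ?_⟩
    rw [Finset.forall_mem_insert, ← h]
    simp only [ExRealize, Formula.realize_inf, Formula.realize_relabel, Sum.elim_comp_map,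
      Function.comp_id]
    constructor
    · rintro ⟨y, h1, h2⟩
      exact ⟨⟨_, h1⟩, ⟨_, h2⟩⟩
    · rintro ⟨⟨y₁, h1⟩, ⟨y₂, h2⟩⟩
      refine ⟨Sum.elim y₁ y₂ ∘ e.symm, ?_, ?_⟩
      · convert h1 using 2
        funext i; simp
      · convert h2 using 2
        funext i; simp

theorem exists_finite_bound {γ : Type*} (δ : L.Formula (γ ⊕ ℕ)) (hδ : δ.IsQF) :
    ∃ (m : ℕ) (δ' : L.Formula (γ ⊕ Fin m)), δ'.IsQF ∧
      ∀ (M : Type w) [L.Structure M] [Nonempty M] (a : γ → M),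
        ExRealize δ a ↔ ∃ y : Fin m → M, δ'.Realize (Sum.elim a y) := by
  classical
  -- Every witness variable that occurs has index at most `N`, so reduction modulo `N + 1` leaves it
  -- unchanged.
  let N := δ.freeVarFinset.toRight.sup id
  refine ⟨N + 1, δ.relabel (Sum.map id (Fin.ofNat (N + 1))), hδ.relabelFormula _,
    fun M _ _ a => ?_⟩
  simp only [ExRealize, Formula.realize_relabel, Sum.elim_comp_map, Function.comp_id]
  constructor
  · rintro ⟨y, hy⟩
    refine ⟨y ∘ (↑), (realize_congr_freeVarFinset δ ?_).1 hy⟩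
    rintro (c | i) hi
    · rfl
    · have : i ≤ N := Finset.le_sup (f := id) (Finset.mem_toRight.2 hi)
      simp [Nat.mod_eq_of_lt (Nat.lt_succ_of_le this)]
  · rintro ⟨y, hy⟩
    exact ⟨_, hy⟩

theorem exists_formula_exRealize {γ : Type*} (δ : L.Formula (γ ⊕ ℕ)) (hδ : δ.IsQF) :
    ∃ χ : L.Formula γ, ∀ (M : Type w) [L.Structure M] [Nonempty M] (a : γ → M),
      χ.Realize a ↔ ExRealize δ a := by
  obtain ⟨m, δ', -, h⟩ := exists_finite_bound.{u, v, w} δ hδ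
  exact ⟨δ'.iExs (Fin m), fun M _ _ a => by rw [Formula.realize_iExs, h]⟩

theorem IsExistential.exists_exs {α : Type*} {k m : ℕ} (χ : L.BoundedFormula α (k + m))
    (hχ : χ.IsExistential) :
    ∃ χ' : L.BoundedFormula α k, χ'.IsExistential ∧ ∀ (M : Type w) [L.Structure M]
      (a : α → M) (x : Fin k → M), χ'.Realize a x ↔ ∃ y : Fin m → M, χ.Realize a (Fin.append x y) := by
  induction m with
  | zero =>
    refine ⟨χ, hχ, fun M _ a x => ?_⟩
    simp [Fin.append_right_nil]
  | succ m ih =>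
    obtain ⟨χ', h', h⟩ := ih (BoundedFormula.ex χ) hχ.ex
    refine ⟨χ', h', fun M _ a x => ?_⟩
    rw [h]
    simp only [realize_ex]
    constructor
    · rintro ⟨y, z, hz⟩
      refine ⟨Fin.snoc y z, ?_⟩
      rw [Fin.append_snoc]
      exact hz
    · rintro ⟨y, hy⟩
      refine ⟨Fin.init y, y (Fin.last m), ?_⟩
      rw [← Fin.append_snoc, Fin.snoc_init_self]
      exact hy

/-- Bridge between the semantic `ExRealize`, which leaves the number of witnesses open, and genuine
existential formulas with `k` variables left to be quantified universally. -/
theorem exists_isExistential {α : Type*} {k : ℕ} (δ : L.Formula ((α ⊕ Fin k) ⊕ ℕ))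
    (hδ : δ.IsQF) :
    ∃ χ : L.BoundedFormula α k, χ.IsExistential ∧
      ∀ (M : Type w) [L.Structure M] [Nonempty M] (a : α → M) (x : Fin k → M),
        χ.Realize a x ↔ ExRealize δ (Sum.elim a x) := by
  obtain ⟨m, δ', hδ', h⟩ := exists_finite_bound.{u, v, w} δ hδ
  obtain ⟨χ, hχ, hr⟩ := IsExistential.exists_exs.{u, v, w} (m := m)
    (show L.BoundedFormula α (k + m + 0) from BoundedFormula.relabel
      (Sum.elim (Sum.map id (Fin.castAdd m)) (Sum.inr ∘ Fin.natAdd k)) δ')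
    (hδ'.relabel _).isExistential
  refine ⟨χ, hχ, fun M _ _ a x => ?_⟩
  rw [hr, h]
  refine exists_congr fun y => ?_
  refine BoundedFormula.realize_relabel.trans ?_
  unfold Formula.Realize
  rw [iff_iff_eq]
  congr 1
  · funext i
    rcases i with (i | i) | i <;> simp
  · exact Subsingleton.elim _ _

theorem IsUniversal.exists_not {α : Type*} {k : ℕ} {χ : L.BoundedFormula α k}
    (h : χ.IsUniversal) : ∃ χ' : L.BoundedFormula α k, χ'.IsExistential ∧
      ∀ (M : Type w) [L.Structure M] (a : α → M) (x : Fin k → M),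
        χ'.Realize a x ↔ ¬ χ.Realize a x := by
  induction h with
  | of_isQF h => exact ⟨_, h.not.isExistential, fun M _ a x => by simp⟩
  | all _ ih =>
    obtain ⟨χ', h', hr⟩ := ih
    exact ⟨χ'.ex, h'.ex, fun M _ a x => by simp [hr]⟩

theorem IsExistential.exists_not {α : Type*} {k : ℕ} {χ : L.BoundedFormula α k}
    (h : χ.IsExistential) : ∃ χ' : L.BoundedFormula α k, χ'.IsUniversal ∧
      ∀ (M : Type w) [L.Structure M] (a : α → M) (x : Fin k → M),
        χ'.Realize a x ↔ ¬ χ.Realize a x := by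
  induction h with
  | of_isQF h => exact ⟨_, h.not.isUniversal, fun M _ a x => by simp⟩
  | ex _ ih =>
    obtain ⟨χ', h', hr⟩ := ih
    exact ⟨χ'.all, h'.all, fun M _ a x => by simp [hr]⟩

end Formulas

/-! ### Elementary chains -/

section Chains

variable {L : FirstOrder.Language.{u, v}}

/-- Tarski's chain argument: only the quantifier step matters, and there an element of the limit
already appears at some stage, which has a common upper bound with stage `i`. -/
theorem directLimit_realize {ι : Type*} [Preorder ι] [IsDirectedOrder ι] [Nonempty ι]
    {G : ι → Type w} [∀ i, L.Structure (G i)] (f : ∀ i j, i ≤ j → G i ↪[L] G j)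
    [DirectedSystem G fun i j h => f i j h] {α : Type*}
    (hf : ∀ i j (h : i ≤ j) (m : ℕ) (φ : L.BoundedFormula α m) (a : α → G i) (x : Fin m → G i),
      φ.Realize (f i j h ∘ a) (f i j h ∘ x) ↔ φ.Realize a x)
    {m : ℕ} (φ : L.BoundedFormula α m) (i : ι) (a : α → G i) (x : Fin m → G i) :
    φ.Realize (DirectLimit.of L ι G f i ∘ a) (DirectLimit.of L ι G f i ∘ x) ↔ φ.Realize a x := by
  induction φ generalizing i with
  | falsum => rfl
  | equal t₁ t₂ =>
    exact (BoundedFormula.IsAtomic.equal t₁ t₂).isQF.realize_embedding (DirectLimit.of L ι G f i)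
  | rel R ts =>
    exact (BoundedFormula.IsAtomic.rel R ts).isQF.realize_embedding (DirectLimit.of L ι G f i)
  | imp _ _ ih₁ ih₂ => simp only [BoundedFormula.realize_imp, ih₁, ih₂]
  | all φ ih =>
    constructor
    · intro h b
      rw [← ih, Fin.comp_snoc]
      exact h _
    · intro h z
      obtain ⟨j, b, rfl⟩ := DirectLimit.exists_of z
      obtain ⟨l, hi, hj⟩ := exists_ge_ge i j
      have h' := (hf i l hi _ _ a x).2 h (f j l hj b)
      rw [← ih, Fin.comp_snoc, DirectLimit.of_f] at h'
      have e₁ : DirectLimit.of L ι G f l ∘ (f i l hi ∘ a) = DirectLimit.of L ι G f i ∘ a :=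
        funext fun _ => DirectLimit.of_f
      have e₂ : DirectLimit.of L ι G f l ∘ (f i l hi ∘ x) = DirectLimit.of L ι G f i ∘ x :=
        funext fun _ => DirectLimit.of_f
      rwa [e₁, e₂] at h'

theorem natLERec_realize {G : ℕ → Type w} [∀ i, L.Structure (G i)]
    (f : ∀ n, G n ↪ₑ[L] G (n + 1)) {α : Type*} (i j : ℕ) (h : i ≤ j) (m : ℕ)
    (φ : L.BoundedFormula α m) (a : α → G i) (x : Fin m → G i) :
    φ.Realize (DirectedSystem.natLERec (fun n => (f n).toEmbedding) i j h ∘ a)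
      (DirectedSystem.natLERec (fun n => (f n).toEmbedding) i j h ∘ x) ↔ φ.Realize a x := by
  induction j, h using Nat.le_induction with
  | base =>
    have e : ∀ z, DirectedSystem.natLERec (fun n => (f n).toEmbedding) i i le_rfl z = z :=
      fun z => by rw [DirectedSystem.coe_natLERec]; exact Nat.leRecOn_self z
    simp only [Function.comp_def, e]
  | succ j h ih =>
    rw [← ih, ← (f j).map_boundedFormula φ]
    have e : ∀ z, DirectedSystem.natLERec (fun n => (f n).toEmbedding) i (j + 1)
        (Nat.le_succ_of_le h) z =
          f j (DirectedSystem.natLERec (fun n => (f n).toEmbedding) i j h z) :=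
      fun z => by simp only [DirectedSystem.coe_natLERec]; exact Nat.leRecOn_succ h z
    simp only [Function.comp_def, e]

/-- The union of an elementary chain. -/
theorem exists_elementary_limit (G : ℕ → Type w) [∀ i, L.Structure (G i)]
    (f : ∀ n, G n ↪ₑ[L] G (n + 1)) :
    ∃ (N : Type w) (_ : L.Structure N) (g : ∀ n, G n ↪ₑ[L] N),
      (∀ n x, g (n + 1) (f n x) = g n x) ∧
      ∀ (k : ℕ) (x : Fin k → N), ∃ (n : ℕ) (y : Fin k → G n), x = g n ∘ y := by
  let F := DirectedSystem.natLERec fun n => (f n).toEmbedding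
  refine ⟨Language.DirectLimit G F, inferInstance, fun n => ⟨DirectLimit.of L ℕ G F n, fun m φ x => ?_⟩,
    fun n x => ?_, fun k x => ?_⟩
  · have := directLimit_realize F (α := Fin m) (natLERec_realize f) φ n x default
    rwa [Subsingleton.elim (_ ∘ default) default] at this
  · have : F n (n + 1) (Nat.le_succ n) x = f n x := by
      simp only [F, DirectedSystem.coe_natLERec]
      exact Nat.leRecOn_succ' x
    rw [← this]
    exact DirectLimit.of_f
  · obtain ⟨n, y, h⟩ := DirectLimit.exists_quotient_mk'_sigma_mk'_eq G F x
    exact ⟨n, y, h⟩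

end Chains

/-! ### The method of diagrams -/

section Diagrams

variable {L : FirstOrder.Language.{u, v}}

theorem exists_elementaryEmbedding {A : Type w} {M : Type w'} [L.Structure A] [L.Structure M]
    (f : A → M) (h : ∀ σ : L.Formula A, σ.Realize id → σ.Realize f) :
    ∃ g : A ↪ₑ[L] M, ⇑g = f := by
  refine ⟨⟨f, fun m φ x => ?_⟩, rfl⟩
  constructor
  · intro hφ
    by_contra hn
    have := h (φ.relabel x).not
    simp only [Formula.realize_not, Formula.realize_relabel, Function.id_comp] at this
    exact this hn hφ
  · intro hφ
    have := h (φ.relabel x)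
    simp only [Formula.realize_relabel, Function.id_comp] at this
    exact this hφ

theorem exists_embedding {B : Type w} {M : Type w'} [L.Structure B] [L.Structure M]
    (f : B → M) (h : ∀ δ : L.Formula B, δ.IsQF → δ.Realize id → δ.Realize f) :
    ∃ g : B ↪[L] M, ⇑g = f := by
  have h' : ∀ δ : L.Formula B, δ.IsQF → (δ.Realize f ↔ δ.Realize id) := by
    refine fun δ hδ => ⟨fun hf => ?_, h δ hδ⟩
    by_contra hn
    exact h δ.not hδ.not hn hf
  refine ⟨⟨⟨f, fun x y hxy => ?_⟩, fun {m} F x => ?_, fun {m} R x => ?_⟩, rfl⟩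
  · have := h' (Term.equal (Term.var x) (Term.var y)) (BoundedFormula.IsAtomic.equal _ _).isQF
    simpa [Formula.realize_equal, hxy] using this
  · have := h' (Term.equal (Term.func F fun i => Term.var (x i)) (Term.var (Structure.funMap F x)))
      (BoundedFormula.IsAtomic.equal _ _).isQF
    simp only [Formula.realize_equal, Term.realize_func, Term.realize_var, id] at this
    exact (this.2 trivial).symm
  · have := h' (R.formula fun i => Term.var (x i)) (BoundedFormula.IsAtomic.rel _ _).isQF
    simpa only [Formula.realize_rel, Term.realize_var, id, Function.comp_def] using this

/-- Every existential formula true of `b` is true of `a`. -/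
def ExPreserved (L : FirstOrder.Language.{u, v}) {γ : Type*} {B : Type w} {A : Type w'}
    [L.Structure B] [L.Structure A] (b : γ → B) (a : γ → A) : Prop :=
  ∀ δ : L.Formula (γ ⊕ ℕ), δ.IsQF → ExRealize δ b → ExRealize δ a

/-- A single formula of the diagram of `B` names finitely many elements, so they can be quantified
away as existential witnesses and found again in `A`. -/
theorem ExPreserved.exists_realize {γ : Type*} {B : Type w} {A : Type w'}
    [L.Structure B] [L.Structure A] [Nonempty B] {b : γ → B} {a : γ → A}
    (h : ExPreserved L b a) (δ : L.Formula (γ ⊕ B)) (hδ : δ.IsQF)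
    (hb : δ.Realize (Sum.elim b id)) : ∃ g : B → A, δ.Realize (Sum.elim a g) := by
  classical
  obtain ⟨b₀⟩ := ‹Nonempty B›
  -- Adding `b₀` makes the set non-empty, so that it is the range of a sequence `e`; `r` picks an
  -- index for each element.
  have hs : (((insert b₀ δ.freeVarFinset.toRight : Finset B)) : Set B).Countable :=
    Finset.countable_toSet _
  obtain ⟨e, he⟩ := hs.exists_eq_range ⟨b₀, by simp⟩
  let r : B → ℕ := Function.invFun e
  have her : ∀ z, Sum.inr z ∈ δ.freeVarFinset → e (r z) = z := fun z hz =>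
    Function.invFun_eq (f := e) (b := z) (by
      have : z ∈ (((insert b₀ δ.freeVarFinset.toRight : Finset B)) : Set B) := by simp [hz]
      rwa [he] at this)
  obtain ⟨y, hy⟩ := h (δ.relabel (Sum.map id r)) (hδ.relabelFormula _) ⟨e, by
    rw [Formula.realize_relabel, Sum.elim_comp_map, Function.comp_id]
    refine (realize_congr_freeVarFinset δ ?_).1 hb
    rintro (c | z) hz
    · rfl
    · simp [her z hz]⟩
  refine ⟨y ∘ r, ?_⟩
  rwa [Formula.realize_relabel, Sum.elim_comp_map, Function.comp_id] at hy

/-- If `a` satisfies all existential consequences of `V ∪ {φ}`, then some realisation of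
`V ∪ {φ}` has all its existential properties shared by `a`. -/
theorem exists_exPreserved {γ : Type} {A : Type max u v w} [L.Structure A] [Nonempty A]
    (V : L.Theory) (φ : L.Formula γ) (a : γ → A)
    (ha : ∀ δ : L.Formula (γ ⊕ ℕ), δ.IsQF →
      (∀ (M : Type max u v w) [L.Structure M] [Nonempty M] (m : γ → M), M ⊨ V → φ.Realize m →
        ExRealize δ m) → ExRealize δ a) :
    ∃ (B : Type max u v w) (_ : L.Structure B) (_ : Nonempty B) (b : γ → B),
      B ⊨ V ∧ φ.Realize b ∧ ExPreserved L b a := by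
  classical
  let I := {δ : L.Formula (γ ⊕ ℕ) // δ.IsQF ∧ ¬ ExRealize δ a}
  choose χ hχ using fun i : I => exists_formula_exRealize.{u, v, max u v w} i.1 i.2.1
  obtain ⟨B, _, _, b, hV, hb⟩ := exists_realize_of_finset.{u, v, 0, w} V
    (fun o : Option I => o.elim φ fun i => (χ i).not) fun F => by
      by_contra hF
      push Not at hF
      let F' : Finset (L.Formula (γ ⊕ ℕ)) := F.eraseNone.image Subtype.val
      -- If the finite part `F` has no model, `V ∪ {φ}` implies the disjunction of the existential
      -- formulas in `F`. By `ha` this disjunction holds at `a`, yet each disjunct was chosen to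
      -- fail there.
      obtain ⟨D, hD, hr⟩ := exists_isQF_disj.{u, v, max u v w} F' (by
        intro δ hδ
        obtain ⟨i, -, rfl⟩ := Finset.mem_image.1 hδ
        exact i.2.1)
      obtain ⟨y, hy⟩ := ha D hD (by
        intro M _ _ m hV hm
        obtain ⟨o, hoF, ho⟩ := hF M inferInstance inferInstance m hV
        cases o with
        | none => exact absurd hm ho
        | some i =>
          have ho' : ExRealize i.1 m := by
            rw [← hχ]
            simpa [Formula.realize_not] using ho
          obtain ⟨y, hy⟩ := ho'
          exact ⟨y, (hr M _).2 ⟨i.1, Finset.mem_image_of_mem _ (Finset.mem_eraseNone.2 hoF), hy⟩⟩)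
      obtain ⟨δ, hδ, hy'⟩ := (hr A _).1 hy
      obtain ⟨i, -, rfl⟩ := Finset.mem_image.1 hδ
      exact i.2.2 ⟨y, hy'⟩
  refine ⟨B, inferInstance, inferInstance, b, hV, hb none, fun δ hδ hδb => ?_⟩
  by_contra hn
  have := hb (some ⟨δ, hδ, hn⟩)
  simp only [Option.elim, Formula.realize_not, hχ] at this
  exact this hδb

/-- Amalgamation: structures `B x` with distinguished tuples embed simultaneously into an
elementary extension of `A`. -/
theorem exists_elementary_extension {A : Type max u v w} [L.Structure A] [Nonempty A]
    {X : Type max u v w} {γ : Type*} (B : X → Type max u v w) [∀ x, L.Structure (B x)] [∀ x, Nonempty (B x)]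
    (a : X → γ → A) (b : ∀ x, γ → B x) (h : ∀ x, ExPreserved L (b x) (a x)) :
    ∃ (M : Type max u v w) (_ : L.Structure M) (f : A ↪ₑ[L] M) (g : ∀ x, B x ↪[L] M),
      ∀ x, g x ∘ b x = f ∘ a x := by
  classical
  let D (x : X) := {δ : L.Formula (γ ⊕ B x) // δ.IsQF ∧ δ.Realize (Sum.elim (b x) id)}
  let lab (x : X) : γ ⊕ B x → A ⊕ Σ x, B x := Sum.map (a x) (Sigma.mk x)
  obtain ⟨M, _, _, t, -, ht⟩ := exists_realize_of_finset.{u, v, max u v w, w} (α := A ⊕ Σ x, B x) ∅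
    (Sum.elim (fun σ : {σ : L.Formula A // σ.Realize id} => σ.1.relabel Sum.inl)
      (fun δ : Σ x, D x => δ.2.1.relabel (lab δ.1))) fun F => by
      -- Finite parts are realised in `A` itself. Different `B x` use disjoint variables, so each
      -- can be treated separately.
      have key : ∀ x, ∃ g : B x → A, ∀ δ : D x, Sum.inr ⟨x, δ⟩ ∈ F →
          δ.1.Realize (Sum.elim (a x) g) := by
        intro x
        let F' : Finset (L.Formula (γ ⊕ B x)) :=
          (F.preimage (fun δ : D x => Sum.inr ⟨x, δ⟩) (by
            intro δ _ δ' _ hd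
            simpa using hd)).image Subtype.val
        obtain ⟨C, hC, hr⟩ := exists_isQF_conj.{u, v, max u v w} F' (by
          intro δ hδ
          obtain ⟨i, -, rfl⟩ := Finset.mem_image.1 hδ
          exact i.2.1)
        obtain ⟨g, hg⟩ := (h x).exists_realize C hC ((hr _ _).2 (by
          intro δ hδ
          obtain ⟨i, -, rfl⟩ := Finset.mem_image.1 hδ
          exact i.2.2))
        exact ⟨g, fun δ hδ => (hr _ _).1 hg _
          (Finset.mem_image_of_mem _ (Finset.mem_preimage.2 hδ))⟩
      choose g hg using key
      refine ⟨A, inferInstance, inferInstance, Sum.elim id fun z => g z.1 z.2, inferInstance, ?_⟩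
      rintro (σ | ⟨x, δ⟩) hi
      · simpa [Formula.realize_relabel] using σ.2
      · have := hg x δ hi
        simp only [Sum.elim_inr, Formula.realize_relabel, lab, Sum.elim_comp_map,
          Function.id_comp]
        exact this
  obtain ⟨f, hf⟩ := exists_elementaryEmbedding (L := L) (t ∘ Sum.inl) fun σ hσ => by
    simpa [Formula.realize_relabel] using ht (Sum.inl ⟨σ, hσ⟩)
  have hB : ∀ x (δ : L.Formula (γ ⊕ B x)), δ.IsQF → δ.Realize (Sum.elim (b x) id) →
      δ.Realize (Sum.elim (t ∘ Sum.inl ∘ a x) fun z => t (Sum.inr ⟨x, z⟩)) := by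
    intro x δ hδ hr
    have := ht (Sum.inr ⟨x, ⟨δ, hδ, hr⟩⟩)
    simp only [Sum.elim_inr, Formula.realize_relabel, lab] at this
    convert this using 1
    funext z
    rcases z with z | z <;> rfl
  choose g hg using fun x => exists_embedding (L := L) (fun z : B x => t (Sum.inr ⟨x, z⟩))
    fun δ hδ hr => by
      have := hB x (δ.relabel Sum.inr) (hδ.relabelFormula _)
      simp only [Formula.realize_relabel, Sum.elim_comp_inr] at this
      exact this hr
  refine ⟨M, inferInstance, f, g, fun x => funext fun c => ?_⟩
  -- The equation between the variable `c` and the element `b x c` belongs to the diagram of `B x`;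
  -- it forces the tuples to be identified in `M`.
  have := hB x (Term.equal (Term.var (Sum.inl c)) (Term.var (Sum.inr (b x c))))
    (BoundedFormula.IsAtomic.equal _ _).isQF
  simp only [Formula.realize_equal, Term.realize_var, Sum.elim_inl, Sum.elim_inr, id,
    Function.comp_apply, forall_const] at this
  rw [Function.comp_apply, hg, hf]
  exact this.symm

end Diagrams

/-! ### Covering all tuples, and extraction of a single formula -/

section Covers

variable {L : FirstOrder.Language.{u, v}} {n : ℕ}

/-- The quantifier-free formulas `δ(x, y, z)` such that `∀ y ∃ z, δ(x, y, z)` holds in all models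
of `V ∪ {φ(x)}`, where `y` has length `k`. -/
def forallExistsConsequences (V : L.Theory) (φ : L.Formula (Fin n)) (k : ℕ) :
    Set (L.Formula ((Fin n ⊕ Fin k) ⊕ ℕ)) :=
  {δ | δ.IsQF ∧ ∀ (M : Type max u v w) [L.Structure M] [Nonempty M] (m : Fin n → M),
    M ⊨ V → φ.Realize m → ∀ x : Fin k → M, ExRealize δ (Sum.elim m x)}

/-- If `(A, p)` satisfies the `∀ᵏ∃*` consequences of `V ∪ {φ}`, then `A` has an elementary
extension `f : A → M` such that every `k`-tuple from `A` lies in an embedded model `(B, b)` of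
`V ∪ {φ}`, with `b` mapped to `f ∘ p`. -/
theorem exists_elementary_extension_of_consequences (V : L.Theory) (φ : L.Formula (Fin n)) (k : ℕ)
    {A : Type max u v w} [L.Structure A] [Nonempty A] (p : Fin n → A)
    (hA : ∀ δ ∈ forallExistsConsequences.{u, v, w} V φ k, ∀ x : Fin k → A,
      ExRealize δ (Sum.elim p x)) :
    ∃ (M : Type max u v w) (_ : L.Structure M) (f : A ↪ₑ[L] M), ∀ x : Fin k → A,
      ∃ (B : Type max u v w) (_ : L.Structure B) (_ : Nonempty B) (b : Fin n → B) (g : B ↪[L] M),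
        B ⊨ V ∧ φ.Realize b ∧ g ∘ b = f ∘ p ∧ ∀ i, f (x i) ∈ Set.range g := by
  -- The distinguished tuple is `p` followed by `x`. As `φ` does not constrain the last `k` entries,
  -- an existential consequence holds for all their values, so it is a `∀ᵏ∃*` consequence.
  have h₁ := fun x : Fin k → A => exists_exPreserved.{u, v, w} V
    (φ.relabel (Sum.inl : Fin n → Fin n ⊕ Fin k)) (Sum.elim p x) (by
      intro δ hδ h
      refine hA δ ⟨hδ, fun M _ _ m hV hm y => h M _ hV ?_⟩ x
      rwa [Formula.realize_relabel, Sum.elim_comp_inl])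
  choose B i₁ i₂ b hV hφ hb using h₁
  obtain ⟨M, _, f, g, hg⟩ := exists_elementary_extension.{u, v, w} B _ b hb
  refine ⟨M, inferInstance, f, fun x => ⟨B x, i₁ x, i₂ x, b x ∘ Sum.inl, g x, hV x, ?_, ?_, ?_⟩⟩
  · rw [← Formula.realize_relabel]
    exact hφ x
  · rw [← Function.comp_assoc, hg, Function.comp_assoc, Sum.elim_comp_inl]
  · exact fun i => ⟨b x (Sum.inr i), congrFun (hg x) (Sum.inr i)⟩

/-- The condition on consequences is first-order, so it passes to the next stage and the extension
can be iterated. -/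
theorem exRealize_elementary_iff {A N : Type w} [L.Structure A] [L.Structure N] [Nonempty A]
    [Nonempty N] (f : A ↪ₑ[L] N) {k : ℕ} (δ : L.Formula ((Fin n ⊕ Fin k) ⊕ ℕ)) (hδ : δ.IsQF)
    (p : Fin n → A) :
    (∀ x : Fin k → N, ExRealize δ (Sum.elim (f ∘ p) x)) ↔
      ∀ x : Fin k → A, ExRealize δ (Sum.elim p x) := by
  obtain ⟨χ, -, h⟩ := exists_isExistential.{u, v, w} δ hδ
  simp only [← h, ← BoundedFormula.realize_alls]
  exact f.map_formula χ.alls p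

/-- Iterating the previous extension `ω` times, all `k`-tuples of the extension are covered. -/
theorem exists_covered_elementary_extension (V : L.Theory) (φ : L.Formula (Fin n)) (k : ℕ)
    {A : Type max u v w} [L.Structure A] [Nonempty A] (p : Fin n → A)
    (hA : ∀ δ ∈ forallExistsConsequences.{u, v, w} V φ k, ∀ x : Fin k → A,
      ExRealize δ (Sum.elim p x)) :
    ∃ (N : Type max u v w) (_ : L.Structure N) (f : A ↪ₑ[L] N), ∀ x : Fin k → N,
      ∃ (B : Type max u v w) (_ : L.Structure B) (_ : Nonempty B) (b : Fin n → B) (g : B ↪[L] N),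
        B ⊨ V ∧ φ.Realize b ∧ g ∘ b = f ∘ p ∧ ∀ i, x i ∈ Set.range g := by
  let Stage := {S : Σ A : Bundled.{max u v w} L.Structure, (Fin n → A) // Nonempty S.1 ∧
    ∀ δ ∈ forallExistsConsequences.{u, v, w} V φ k, ∀ x : Fin k → S.1,
      ExRealize δ (Sum.elim S.2 x)}
  have step : ∀ S : Stage, ∃ (T : Stage) (f : S.1.1 ↪ₑ[L] T.1.1), T.1.2 = f ∘ S.1.2 ∧
      ∀ x : Fin k → S.1.1,
        ∃ (B : Type max u v w) (_ : L.Structure B) (_ : Nonempty B) (b : Fin n → B)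
          (g : B ↪[L] T.1.1), B ⊨ V ∧ φ.Realize b ∧ g ∘ b = f ∘ S.1.2 ∧
            ∀ i, f (x i) ∈ Set.range g := by
    rintro ⟨⟨S, p⟩, hne, hS⟩
    have : Nonempty S := hne
    obtain ⟨M, _, f, h⟩ := exists_elementary_extension_of_consequences V φ k p hS
    have : Nonempty M := hne.map f
    exact ⟨⟨⟨Bundled.of M, f ∘ p⟩, this, fun δ hδ =>
      (exRealize_elementary_iff f δ hδ.1 p).2 (hS δ hδ)⟩, f, rfl, h⟩
  choose next f hp hf using step
  let G : ℕ → Stage := fun i => next^[i] ⟨⟨Bundled.of A, p⟩, ‹Nonempty A›, hA⟩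
  have hG : ∀ i, G (i + 1) = next (G i) := fun i => Function.iterate_succ_apply' _ _ _
  -- Keeping `f` under the existential allows rewriting along `hG`.
  have step' : ∀ i, ∃ f : (G i).1.1 ↪ₑ[L] (G (i + 1)).1.1, (G (i + 1)).1.2 = f ∘ (G i).1.2 ∧
      ∀ x : Fin k → (G i).1.1,
        ∃ (B : Type max u v w) (_ : L.Structure B) (_ : Nonempty B) (b : Fin n → B)
          (g : B ↪[L] (G (i + 1)).1.1), B ⊨ V ∧ φ.Realize b ∧ g ∘ b = f ∘ (G i).1.2 ∧
            ∀ j, f (x j) ∈ Set.range g := by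
    intro i
    rw [hG]
    exact ⟨f _, hp _, hf _⟩
  choose F hFp hF using step'
  obtain ⟨N, _, g, hg, hN⟩ := exists_elementary_limit (fun i => (G i).1.1) F
  have hgp : ∀ i, g i ∘ (G i).1.2 = g 0 ∘ p := by
    intro i
    induction i with
    | zero => rfl
    | succ i ih =>
      rw [hFp, ← ih]
      exact funext fun _ => hg _ _
  refine ⟨N, inferInstance, g 0, fun x => ?_⟩
  obtain ⟨i, y, rfl⟩ := hN k x
  obtain ⟨B, _, _, b, e, hV, hb, heb, hy⟩ := hF i y
  refine ⟨B, inferInstance, inferInstance, b, (g (i + 1)).toEmbedding.comp e, hV, hb, ?_, ?_⟩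
  · refine Eq.trans (funext fun j => ?_) (hgp i)
    have := congrFun heb j
    simp only [Function.comp_apply] at this
    simp [this, hg]
  · intro j
    obtain ⟨z, hz⟩ := hy j
    exact ⟨z, by simp [hz, hg]⟩

/-- If the `∀ᵏ∃*` consequences of `V ∪ {φ}` entail `φ` modulo `V`, then a single one does. -/
theorem exists_isForallExists_of_consequences (V : L.Theory) (φ : L.Formula (Fin n)) (k : ℕ)
    (h : ∀ (A : Type max u v w) [L.Structure A] [Nonempty A] (p : Fin n → A), A ⊨ V →
      (∀ δ ∈ forallExistsConsequences.{u, v, w} V φ k, ∀ x : Fin k → A,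
        ExRealize δ (Sum.elim p x)) → φ.Realize p) :
    ∃ ψ : L.Formula (Fin n), IsForallExists k ψ ∧ EquivalentModulo.{u, v, max u v w} V φ ψ := by
  classical
  choose! χ hχE hχ using fun δ (hδ : δ ∈ forallExistsConsequences.{u, v, w} V φ k) =>
    exists_isExistential.{u, v, max u v w} δ hδ.1
  obtain ⟨F, hF⟩ : ∃ F : Finset (Option (forallExistsConsequences.{u, v, w} V φ k)),
      ∀ (A : Type max u v w) [L.Structure A] [Nonempty A] (p : Fin n → A), A ⊨ V →
        ∃ i ∈ F, ¬ (i.elim φ.not fun δ => (χ δ.1).alls : L.Formula (Fin n)).Realize p := by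
    by_contra! hF
    obtain ⟨A, _, _, p, hV, hp⟩ := exists_realize_of_finset.{u, v, 0, w} V
      (fun i : Option (forallExistsConsequences.{u, v, w} V φ k) =>
        (i.elim φ.not fun δ => (χ δ.1).alls : L.Formula (Fin n))) fun F => by
          obtain ⟨A, i₁, i₂, p, hV, hp⟩ := hF F
          exact ⟨A, i₁, i₂, p, hV, hp⟩
    refine hp none (h A p hV fun δ hδ x => ?_)
    rw [← hχ δ hδ]
    exact BoundedFormula.realize_alls.1 (hp (some ⟨δ, hδ⟩)) x
  have hF' : ∀ δ ∈ F.eraseNone.image Subtype.val,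
      δ ∈ forallExistsConsequences.{u, v, w} V φ k := by
    intro δ hδ
    obtain ⟨i, -, rfl⟩ := Finset.mem_image.1 hδ
    exact i.2
  -- Universal quantifiers distribute over conjunctions, so all chosen consequences share one block
  -- of `k` universal quantifiers.
  obtain ⟨D, hD, hr⟩ := exists_exRealize_conj.{u, v, max u v w}
    (F.eraseNone.image Subtype.val) fun δ hδ => (hF' δ hδ).1
  obtain ⟨ψ, hψ, hψr⟩ := exists_isExistential.{u, v, max u v w} D hD
  refine ⟨ψ.alls, ⟨ψ, hψ, rfl⟩, fun A _ _ p => ?_⟩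
  rw [and_congr_left_iff]
  intro hV
  rw [BoundedFormula.realize_alls]
  simp only [hψr, hr]
  constructor
  · exact fun hφ x δ hδ => (hF' δ hδ).2 A p hV hφ x
  · intro hp
    obtain ⟨i, hi, hn⟩ := hF A p hV
    cases i with
    | none => exact not_not.1 hn
    | some δ =>
      refine absurd (BoundedFormula.realize_alls.2 fun x => ?_) hn
      rw [hχ _ δ.2]
      exact hp x _ (Finset.mem_image_of_mem _ (Finset.mem_eraseNone.2 hi))

end Covers

/-! ### Duality between hereditary and extension closed classes -/

section Duality

variable {L : FirstOrder.Language.{u, v}}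

/-- `A` has no `k`-crux exactly when its substructures in `U \ S` form a `k`-ary cover. -/
theorem hereditaryOver_iff_extensionClosedOver_diff (k : ℕ)
    {S U : Set (Bundled.{w} L.Structure)} (hS : S ⊆ U) :
    HereditaryOver k S U ↔ ExtensionClosedOver k (U \ S) U := by
  constructor
  · rintro ⟨-, h⟩
    refine ⟨Set.sdiff_subset, fun A hA R hR hc => ⟨hA, fun hAS => ?_⟩⟩
    obtain ⟨C, hC, hB⟩ := h A hAS
    obtain ⟨B, hBR, hCB⟩ := hc.2 C hC
    exact (hR B hBR).2 (hB B hCB (hR B hBR).1)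
  · rintro ⟨-, h⟩
    refine ⟨hS, fun A hA => ?_⟩
    by_contra! hn
    refine (h A (hS hA) {B | substr B ∈ U \ S} (fun _ h => h) ?_).2 hA
    have hcov : ∀ C : Finset A, C.card ≤ k →
        ∃ B ∈ {B : L.Substructure A | substr B ∈ U \ S}, (C : Set A) ⊆ (B : Set A) := by
      intro C hC
      have := hn C
      simp only [IsCrux, not_and, not_forall] at this
      obtain ⟨B, hCB, hU, hB⟩ := this hC
      exact ⟨B, ⟨hU, hB⟩, hCB⟩
    -- The empty set, of size at most `k`, shows that the cover is non-empty.
    exact ⟨(hcov ∅ (by simp)).imp fun _ h => h.1, hcov⟩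

end Duality

/-! ### Expansions by constants, and both directions of the equivalence -/

section Expansions

variable {L : FirstOrder.Language.{u, v}} {n : ℕ}

theorem mem_modelClass_expandTheory {A : Type w} [L.Structure A] [S : (L[[Fin n]]).Structure A]
    [(L.lhomWithConstants (Fin n)).IsExpansionOn A] (V : L.Theory) :
    (⟨A, S⟩ : Bundled.{w} (L[[Fin n]]).Structure) ∈ modelClass (expandTheory n V) ↔
      Nonempty A ∧ A ⊨ V :=
  and_congr_right fun _ => LHom.onTheory_model _ _

theorem mem_modelClass_closeTheory_union {A : Type w} [L.Structure A]
    [S : (L[[Fin n]]).Structure A] [(L.lhomWithConstants (Fin n)).IsExpansionOn A]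
    (φ : L.Formula (Fin n)) (V : L.Theory) :
    (⟨A, S⟩ : Bundled.{w} (L[[Fin n]]).Structure) ∈
        modelClass (closeTheory {φ} ∪ expandTheory n V) ↔
      Nonempty A ∧ A ⊨ V ∧ φ.Realize fun i => (L.con i : A) := by
  refine and_congr_right fun _ => ?_
  change Theory.Model A (closeTheory {φ} ∪ expandTheory n V) ↔ _
  rw [Theory.model_union_iff, and_comm, closeTheory, Set.image_singleton,
    Theory.model_singleton_iff, Formula.realize_equivSentence]
  exact and_congr_left fun _ => LHom.onTheory_model _ _

theorem modelClass_closeTheory_not (φ : L.Formula (Fin n)) (V : L.Theory) :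
    modelClass.{u, v, w} (closeTheory {∼φ} ∪ expandTheory n V) =
      modelClass (expandTheory n V) \ modelClass (closeTheory {φ} ∪ expandTheory n V) := by
  ext ⟨A, S⟩
  let : L.Structure A := (L.lhomWithConstants (Fin n)).reduct A
  rw [Set.mem_sdiff, mem_modelClass_expandTheory, mem_modelClass_closeTheory_union,
    mem_modelClass_closeTheory_union, Formula.realize_not]
  tauto

theorem formulaHereditary_iff_not (k : ℕ) (φ : L.Formula (Fin n)) (V : L.Theory) :
    FormulaHereditary.{u, v, w} k φ V ↔ FormulaExtensionClosed.{u, v, w} k (∼φ) V := by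
  unfold FormulaHereditary TheoryHereditary FormulaExtensionClosed TheoryExtensionClosed
  rw [modelClass_closeTheory_not]
  exact hereditaryOver_iff_extensionClosedOver_diff k fun A hA =>
    ⟨hA.1, Theory.Model.mono hA.2 Set.subset_union_right⟩

theorem exists_isExistsForall_iff_not (k : ℕ) (φ : L.Formula (Fin n)) (V : L.Theory) :
    (∃ ψ : L.Formula (Fin n), IsExistsForall k ψ ∧ EquivalentModulo.{u, v, w} V φ ψ) ↔
      ∃ ψ : L.Formula (Fin n), IsForallExists k ψ ∧ EquivalentModulo.{u, v, w} V (∼φ) ψ := by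
  constructor
  · rintro ⟨_, ⟨χ, hχ, rfl⟩, h⟩
    obtain ⟨χ', hχ', hr⟩ := IsUniversal.exists_not.{u, v, w} hχ
    refine ⟨χ'.alls, ⟨χ', hχ', rfl⟩, fun A _ _ a => and_congr_left fun hV => ?_⟩
    have := (and_congr_left_iff.1 (h A a)) hV
    rw [Formula.realize_not, this, BoundedFormula.realize_exs, BoundedFormula.realize_alls]
    simp [hr]
  · rintro ⟨_, ⟨χ, hχ, rfl⟩, h⟩
    obtain ⟨χ', hχ', hr⟩ := IsExistential.exists_not.{u, v, w} hχ
    refine ⟨χ'.exs, ⟨χ', hχ', rfl⟩, fun A _ _ a => and_congr_left fun hV => ?_⟩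
    have := (and_congr_left_iff.1 (h A a)) hV
    rw [Formula.realize_not, BoundedFormula.realize_alls] at this
    rw [← not_not (a := φ.Realize a), this, BoundedFormula.realize_exs]
    simp [hr]

theorem formulaExtensionClosed_of_isForallExists {k : ℕ} {φ ψ : L.Formula (Fin n)}
    {V : L.Theory} (hψ : IsForallExists k ψ) (h : EquivalentModulo.{u, v, w} V φ ψ) :
    FormulaExtensionClosed.{u, v, w} k φ V := by
  classical
  obtain ⟨χ, hχ, rfl⟩ := hψ
  refine ⟨fun A hA => ⟨hA.1, Theory.Model.mono hA.2 Set.subset_union_right⟩, ?_⟩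
  rintro ⟨A, S⟩ hA R hR ⟨-, hc⟩
  let : L.Structure A := (L.lhomWithConstants (Fin n)).reduct A
  obtain ⟨hne, hV⟩ := (mem_modelClass_expandTheory V).1 hA
  have : Nonempty A := hne
  rw [mem_modelClass_closeTheory_union]
  refine ⟨hne, hV, ((h A _).2 ⟨BoundedFormula.realize_alls.2 fun x => ?_, hV⟩).1⟩
  obtain ⟨B, hBR, hxB⟩ := hc (Finset.univ.image x) (Finset.card_image_le.trans (by simp))
  let : L.Structure B := (L.lhomWithConstants (Fin n)).reduct B
  obtain ⟨hneB, hVB, hφB⟩ := (mem_modelClass_closeTheory_union φ V).1 (hR B hBR)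
  have : Nonempty B := hneB
  let g : B ↪[L] A :=
    { toFun := Subtype.val
      inj' := Subtype.val_injective
      map_fun' := fun _ _ => rfl
      map_rel' := fun _ _ => Iff.rfl }
  have hx : ∀ i, x i ∈ B := fun i => hxB (by simp)
  have := BoundedFormula.realize_alls.1 ((h B _).1 ⟨hφB, hVB⟩).1 fun i => ⟨x i, hx i⟩
  have hg : g ∘ (fun i : Fin n => ((L.con i : (L[[Fin n]]).Constants) : B)) =
      fun i => ((L.con i : (L[[Fin n]]).Constants) : A) := by
    funext i
    change Structure.funMap (L.con i) (Subtype.val ∘ default) = Structure.funMap (L.con i) default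
    rw [Subsingleton.elim (Subtype.val ∘ default) default]
  rw [← hg]
  exact hχ.realize_embedding g this

/-- The range of an embedding respecting the named constants, as a substructure of the
expansion. -/
def rangeWithConstants {B : Type w} {N : Type w'} [L.Structure B] [L.Structure N]
    [(L[[Fin n]]).Structure N] [(L.lhomWithConstants (Fin n)).IsExpansionOn N] (g : B ↪[L] N)
    (b : Fin n → B) (hb : ∀ i, g (b i) = (L.con i : N)) : (L[[Fin n]]).Substructure N where
  carrier := Set.range g
  fun_mem {m} F x hx := by
    rcases F with F | c
    · choose y hy using hx
      rw [withConstants_funMap_sumInl]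
      exact ⟨Structure.funMap F y, by rw [g.map_fun]; exact congrArg _ (funext hy)⟩
    · cases m with
      | zero => exact ⟨b c, (hb c).trans
          (congrArg (Structure.funMap (L := L[[Fin n]]) (Sum.inr c)) (Subsingleton.elim default x))⟩
      | succ m => exact isEmptyElim c

theorem exists_range_superset {A : Type*} [Nonempty A] {k : ℕ} (C : Finset A) (hC : C.card ≤ k) :
    ∃ x : Fin k → A, (C : Set A) ⊆ Set.range x := by
  -- Sets with fewer than `k` elements are padded with an arbitrary element.
  refine ⟨fun i => if h : i.1 < C.card then C.equivFin.symm ⟨i, h⟩ else Classical.arbitrary A,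
    fun a ha => ⟨⟨C.equivFin ⟨a, ha⟩, (Fin.is_lt _).trans_le hC⟩, by simp⟩⟩

/-- The ranges of the embeddings `g` contain the named constants, so they are substructures of `(N,
p)`, and they cover it. -/
theorem realize_of_extensionClosed {k : ℕ} {φ : L.Formula (Fin n)} {V : L.Theory}
    (h : FormulaExtensionClosed.{u, v, w} k φ V) {N : Type w} [L.Structure N] [Nonempty N]
    (p : Fin n → N) (hV : N ⊨ V)
    (hN : ∀ x : Fin k → N, ∃ (B : Type w) (_ : L.Structure B) (_ : Nonempty B) (b : Fin n → B)
      (g : B ↪[L] N), B ⊨ V ∧ φ.Realize b ∧ g ∘ b = p ∧ ∀ i, x i ∈ Set.range g) :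
    φ.Realize p := by
  let := constantsOn.structure p
  let NN : Bundled.{w} (L[[Fin n]]).Structure := ⟨N, inferInstance⟩
  have hcov : ∀ C : Finset NN, C.card ≤ k → ∃ B ∈ {B : (L[[Fin n]]).Substructure NN |
      substr B ∈ modelClass.{u, v, w} (closeTheory {φ} ∪ expandTheory n V)},
      (C : Set NN) ⊆ (B : Set NN) := by
    intro C hC
    obtain ⟨x, hx⟩ := exists_range_superset (A := N) C hC
    obtain ⟨B, _, hne, b, g, hVB, hφB, hgb, hxg⟩ := hN x
    let S : (L[[Fin n]]).Substructure N := rangeWithConstants g b fun i => congrFun hgb i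
    refine ⟨S, ?_, hx.trans (by rintro _ ⟨i, rfl⟩; exact hxg i)⟩
    let : L.Structure S := (L.lhomWithConstants (Fin n)).reduct S
    let e : B ≃[L] S :=
      { toEquiv := Equiv.ofInjective g g.injective
        map_fun' := fun F x => Subtype.ext (g.map_fun F x)
        map_rel' := fun R x => g.map_rel R x }
    have he : e ∘ b = fun i => (L.con i : S) := by
      funext i
      exact Subtype.ext (congrFun hgb i)
    refine (mem_modelClass_closeTheory_union φ V).2 ⟨hne.map e, ?_, ?_⟩
    · exact StrongHomClass.theory_model e
    · rw [← he]
      exact (StrongHomClass.realize_formula e φ).2 hφB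
  have hmem := h.2 NN ((mem_modelClass_expandTheory V).2 ⟨inferInstance, hV⟩) _ (fun _ h => h)
    ⟨(hcov ∅ (by simp)).imp fun _ h => h.1, hcov⟩
  exact ((mem_modelClass_closeTheory_union φ V).1 hmem).2.2

theorem exists_isForallExists_of_extensionClosed {k : ℕ} {φ : L.Formula (Fin n)} {V : L.Theory}
    (h : FormulaExtensionClosed.{u, v, max u v w} k φ V) :
    ∃ ψ : L.Formula (Fin n), IsForallExists k ψ ∧ EquivalentModulo.{u, v, max u v w} V φ ψ := by
  refine exists_isForallExists_of_consequences.{u, v, w} V φ k fun A _ hne p hV hp => ?_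
  obtain ⟨N, _, f, hN⟩ := exists_covered_elementary_extension.{u, v, w} V φ k p hp
  have : Nonempty N := hne.map f
  exact (f.map_formula φ p).1
    (realize_of_extensionClosed h (f ∘ p) ((f.theory_model_iff V).1 hV) hN)

theorem formulaExtensionClosed_iff (k : ℕ) (φ : L.Formula (Fin n)) (V : L.Theory) :
    FormulaExtensionClosed.{u, v, max u v w} k φ V ↔
      ∃ ψ : L.Formula (Fin n),
        IsForallExists k ψ ∧ EquivalentModulo.{u, v, max u v w} V φ ψ :=
  ⟨exists_isForallExists_of_extensionClosed, fun ⟨_, hψ, h⟩ =>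
    formulaExtensionClosed_of_isForallExists hψ h⟩

end Expansions

end GLT

/-! ### The generalized Łoś–Tarski theorem -/

theorem mainTheorem1 {L : FirstOrder.Language.{u, v}} {n : ℕ} (φ : L.Formula (Fin n))
    (V : L.Theory) (k : ℕ) :
    (GLT.FormulaHereditary.{u, v, max u v w} k φ V ↔
      ∃ ψ : L.Formula (Fin n),
        GLT.IsExistsForall k ψ ∧ GLT.EquivalentModulo.{u, v, max u v w} V φ ψ) ∧
    (GLT.FormulaExtensionClosed.{u, v, max u v w} k φ V ↔
      ∃ ψ : L.Formula (Fin n),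
        GLT.IsForallExists k ψ ∧ GLT.EquivalentModulo.{u, v, max u v w} V φ ψ) := by
  refine ⟨?_, GLT.formulaExtensionClosed_iff.{u, v, w} k φ V⟩
  rw [GLT.formulaHereditary_iff_not, GLT.exists_isExistsForall_iff_not]
  exact GLT.formulaExtensionClosed_iff.{u, v, w} k (∼φ) V
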